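/- Let $\phi_i^{(1)}=T_i$ and $\phi_i^{(2)}=U_i$ be the Chebyshev polynomials of the first and second kind. Let $r\in\{1,2\}$, let $m,n\ge 1$, $k\ge 1$ and $0\le\epsilon\le k-1$ be integers, let $P_0,\dots,P_k\in\mathbb{C}^{m\times n}$, and let $P(\lambda)=\sum_{i=0}^k P_i\,\phi_i^{(r)}(\lambda)$, regarded as a matrix polynomial of grade $k$. For $q\ge 0$, $p\ge1$ and $j\in\{1,2\}$ let $K^{(j)}_{q,p}(\lambda)$ be the $qp\times(q+1)p$ pencil of $p\times p$ blocks $$K^{(j)}_{q,p}(\lambda)=\begin{bmatrix} I_p&-2\lambda I_p&I_p\\ &\ddots&\ddots&\ddots\\ &&I_p&-2\lambda I_p&I_p\\ &&&I_p&-\phi^{(j)}_1(\lambda)I_p\end{bmatrix},$$ and put $K_1=K^{(r)}_{\epsilon,n}$ and $K_2=K^{(2)}_{k-1-\epsilon,m}$. Define the $(k-\epsilon)m\times(\epsilon+1)n$ pencil $M_\epsilon$ as follows. * If $1\le\epsilon\le k-2$, the blocks of $M_\epsilon$ are $$M_\epsilon(\lambda)=\begin{bmatrix} 2\lambda P_k+P_{k-1}&-P_k&0&\cdots&0\\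 P_{k-2}-P_k&-P_{k-1}&\vdots&&\vdots\\ P_{k-3}&\vdots&\vdots&&\vdots\\ \vdots&-P_{\epsilon+2}&0&\cdots&0\\ P_\epsilon&P_{\epsilon-1}-P_{\epsilon+1}&P_{\epsilon-2}&\cdots&P_0\end{bmatrix},$$ where for $\epsilon=k-2$ the second row is the last one and starts with $P_{k-2}-P_k$. * If $\epsilon=k-1\ge1$, $M_\epsilon(\lambda)$ is the block row with the blocks $2\lambda P_k+P_{k-1},\ P_{k-2}-P_k,\ P_{k-3},\ \dots,\ P_0$. * If $\epsilon=0$ and $r=2$, $M_\epsilon(\lambda)$ is the block column with the same blocks $2\lambda P_k+P_{k-1},\ P_{k-2}-P_k,\ P_{k-3},\ \dots,\ P_0$ (only $2\lambda P_1+P_0$ if $k=1$). * If $\epsilon=0$ and $r=1$, $M_\epsilon(\lambda)$ is $\tfrac12$ times the block column with the blocks $2\lambda P_k+P_{k-1},\ P_{k-2}-2P_k,\ P_{k-3}-P_{k-1},\ \dots,\ P_1-P_3,\ 2P_0-P_2$; for $k=2$ these are $2\lambda P_2+P_1,\ 2P_0-2P_2$, and for $k=1$ the only block is $2\lambda P_1+2P_0$.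 Let $A\in\mathbb{C}^{(k-\epsilon)m\times\epsilon n}$ and $B\in\mathbb{C}^{(k-1-\epsilon)m\times(\epsilon+1)n}$ be arbitrary. Then $$C(\lambda)=\begin{bmatrix} M_\epsilon(\lambda)+A\,K_1(\lambda)+K_2(\lambda)^T B & K_2(\lambda)^T\\ K_1(\lambda)&0\end{bmatrix}$$ is a strong block minimal basis pencil and a strong linearization of $P(\lambda)$. Here the rows of a matrix polynomial form a minimal basis if they are linearly independent over $\mathbb{C}(\lambda)$ and the sum of their degrees is least among all polynomial bases of the rational subspace that they span; two minimal bases $K,D$ with the same number $c$ of columns are dual if their numbers of rows add up to $c$ and $KD^T=0$. That $C$ is a strong block minimal basis pencil means that $C$ has entries of degree at most $1$, that $K_1$ and $K_2$ are minimal bases with all row degrees equal to $1$, and that each of them has a dual minimal basis whose row degrees are all equal. A pencil $L$ is a linearization of $P$ if $U(\lambda)L(\lambda)V(\lambda)=\operatorname{diag}(I_s,P(\lambda))$ for some integer $s\ge0$ and some matrix polynomials $U,V$ whose determinants are nonzero constants (here $s=(k-1-\epsilon)m+\epsilon n$, which is positive unless $k=1$). It is strong if moreover $\lambda L(1/\lambda)$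 is a linearization of $\lambda^kP(1/\lambda)$. -/

import Mathlib

open Polynomial

namespace ChebPencil

noncomputable section

/-! ## Matrix polynomials, minimal bases, strong linearizations

A matrix polynomial is a matrix with entries in `ℂ[X]`. -/

/-- A constant matrix, seen as a matrix polynomial. -/
def const {ρ κ : Type*} (A : Matrix ρ κ ℂ) : Matrix ρ κ ℂ[X] :=
  A.map C

/-- `P` has grade `k`: all entries have degree at most `k`. -/
def HasGrade {ρ κ : Type*} (k : ℕ) (P : Matrix ρ κ ℂ[X]) : Prop :=
  ∀ i j, (P i j).natDegree ≤ k

/-- A matrix pencil is a matrix polynomial of grade `1`. -/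
def IsPencil {ρ κ : Type*} (L : Matrix ρ κ ℂ[X]) : Prop :=
  HasGrade 1 L

/-- The `k`-reversal `λ ^ k * P (1 / λ)` of a matrix polynomial of grade `k`. -/
def rev {ρ κ : Type*} (k : ℕ) (P : Matrix ρ κ ℂ[X]) : Matrix ρ κ ℂ[X] :=
  P.map (reflect k)

/-- A square matrix polynomial whose determinant is a nonzero constant. -/
def IsUnimodular {ι : Type*} [Fintype ι] [DecidableEq ι] (U : Matrix ι ι ℂ[X]) : Prop :=
  ∃ c : ℂ, c ≠ 0 ∧ U.det = C c

/-- `L` is a linearization of `P`: there are unimodular `U`, `V` with `U L V = diag (I_s, P)`.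
The bijections `e₁`, `e₂` only number the rows and columns of `L`; they exist exactly when `L` has
`s + m` rows and `s + n` columns, so that `s` is determined by the sizes. -/
def IsLinearization {ρ κ : Type*} {m n : ℕ} (L : Matrix ρ κ ℂ[X])
    (P : Matrix (Fin m) (Fin n) ℂ[X]) : Prop :=
  IsPencil L ∧
  ∃ (s : ℕ) (e₁ : ρ ≃ Fin s ⊕ Fin m) (e₂ : κ ≃ Fin s ⊕ Fin n)
    (U : Matrix (Fin s ⊕ Fin m) (Fin s ⊕ Fin m) ℂ[X])
    (V : Matrix (Fin s ⊕ Fin n) (Fin s ⊕ Fin n) ℂ[X]),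
    IsUnimodular U ∧ IsUnimodular V ∧
      U * Matrix.reindex e₁ e₂ L * V = Matrix.fromBlocks 1 0 0 P

/-- `L` is a strong linearization of `P`, where `P` is regarded as a matrix polynomial of
grade `k`. -/
def IsStrongLinearization {ρ κ : Type*} {m n : ℕ} (k : ℕ) (L : Matrix ρ κ ℂ[X])
    (P : Matrix (Fin m) (Fin n) ℂ[X]) : Prop :=
  HasGrade k P ∧ IsLinearization L P ∧ IsLinearization (rev 1 L) (rev k P)

/-- The degree of the `i`-th row. -/
def rowDegree {ρ κ : Type*} [Fintype κ] (K : Matrix ρ κ ℂ[X]) (i : ρ) : ℕ :=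
  Finset.univ.sup fun j => (K i j).natDegree

/-- The `i`-th row, as a vector over the field of rational functions. -/
def ratRow {ρ κ : Type*} (K : Matrix ρ κ ℂ[X]) (i : ρ) : κ → RatFunc ℂ :=
  fun j => algebraMap ℂ[X] (RatFunc ℂ) (K i j)

/-- The rational subspace spanned by the rows. -/
def rowSpan {ρ κ : Type*} (K : Matrix ρ κ ℂ[X]) : Submodule (RatFunc ℂ) (κ → RatFunc ℂ) :=
  Submodule.span (RatFunc ℂ) (Set.range (ratRow K))

/-- The rows of `K` form a minimal basis of the rational subspace that they span: they are a basis
of it, and have the least order (sum of degrees) among all its polynomial bases. -/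
def IsMinimalBasis {ρ κ : Type*} [Fintype ρ] [Fintype κ] (K : Matrix ρ κ ℂ[X]) : Prop :=
  LinearIndependent (RatFunc ℂ) (ratRow K) ∧
  ∀ Q : Matrix ρ κ ℂ[X], LinearIndependent (RatFunc ℂ) (ratRow Q) → rowSpan Q = rowSpan K →
    ∑ i, rowDegree K i ≤ ∑ i, rowDegree Q i

/-- `K` and `D` are dual minimal bases. -/
def AreDualMinimalBases {ρ σ κ : Type*} [Fintype ρ] [Fintype σ] [Fintype κ]
    (K : Matrix ρ κ ℂ[X]) (D : Matrix σ κ ℂ[X]) : Prop :=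
  IsMinimalBasis K ∧ IsMinimalBasis D ∧
    Fintype.card ρ + Fintype.card σ = Fintype.card κ ∧ K * D.transpose = 0

/-- A minimal basis with all row degrees equal to `1`, such that the row degrees of a minimal basis
dual to it are all equal. -/
def IsStrongMinimalBasis {ρ κ : Type*} [Fintype ρ] [Fintype κ] (K : Matrix ρ κ ℂ[X]) : Prop :=
  IsMinimalBasis K ∧ (∀ i, rowDegree K i = 1) ∧
    ∃ (d q : ℕ) (D : Matrix (Fin q) κ ℂ[X]), AreDualMinimalBases K D ∧ ∀ i, rowDegree D i = d

/-- The matrix `[M, K₂ᵀ; K₁, 0]`. -/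
def blockPencil {ρ₁ κ₁ ρ₂ κ₂ : Type*} (M : Matrix κ₂ κ₁ ℂ[X]) (K₁ : Matrix ρ₁ κ₁ ℂ[X])
    (K₂ : Matrix ρ₂ κ₂ ℂ[X]) : Matrix (κ₂ ⊕ ρ₁) (κ₁ ⊕ ρ₂) ℂ[X] :=
  Matrix.fromBlocks M K₂.transpose K₁ 0

/-- `[M, K₂ᵀ; K₁, 0]` is a strong block minimal basis pencil with body `M`. -/
def IsStrongBlockMinimalBasisPencil {ρ₁ κ₁ ρ₂ κ₂ : Type*} [Fintype ρ₁] [Fintype κ₁] [Fintype ρ₂]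
    [Fintype κ₂] (M : Matrix κ₂ κ₁ ℂ[X]) (K₁ : Matrix ρ₁ κ₁ ℂ[X])
    (K₂ : Matrix ρ₂ κ₂ ℂ[X]) : Prop :=
  IsPencil (blockPencil M K₁ K₂) ∧ IsStrongMinimalBasis K₁ ∧ IsStrongMinimalBasis K₂

/-! ## The Chebyshev pencils -/

/-- The two kinds of Chebyshev polynomials. -/
inductive Kind
  | first
  | second

/-- The Chebyshev polynomial `φ_i` of the given kind. -/
def phi : Kind → ℕ → ℂ[X]
  | Kind.first, i => Chebyshev.T ℂ i
  | Kind.second, i => Chebyshev.U ℂ i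

/-- The matrix polynomial `∑_{i = 0}^k P_i φ_i`. Only `P 0, …, P k` matter here and below. -/
def chebSum {m n : ℕ} (r : Kind) (k : ℕ) (P : ℕ → Matrix (Fin m) (Fin n) ℂ) :
    Matrix (Fin m) (Fin n) ℂ[X] :=
  ∑ i ∈ Finset.range (k + 1), phi r i • const (P i)

/-- The pencil with `q` block rows and `q + 1` block columns, all blocks of size `n × n`,
whose block row `a` (counted from `0`) is `I, -2λ I, I` in the block columns `a, a + 1, a + 2` for
`a + 1 < q`, and `I, -φ₁ I` in the last two block columns for `a + 1 = q`. -/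
def chebK (r : Kind) (q n : ℕ) : Matrix (Fin q × Fin n) (Fin (q + 1) × Fin n) ℂ[X] :=
  Matrix.of fun x y =>
    if x.2 = y.2 then
      if y.1.val = x.1.val then 1
      else if y.1.val = x.1.val + 1 then (if x.1.val + 1 = q then -phi r 1 else -(2 * X))
      else if y.1.val = x.1.val + 2 then 1
      else 0
    else 0

/-- Block `a` of the body for `ε = 0` and Chebyshev polynomials of the first kind:
`1/2 [2λ P_k + P_{k-1}, P_{k-2} - 2 P_k, P_{k-3} - P_{k-1}, …, P_1 - P_3, 2 P_0 - P_2]`,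
as a block column (for `k = 2` the second block, which is also the last one, is
`1/2 (2 P_0 - 2 P_2)`; for `k = 1` the only block is `1/2 (2λ P_1 + 2 P_0)`). -/
def bodyBlockZeroFirst {m n : ℕ} (k : ℕ) (P : ℕ → Matrix (Fin m) (Fin n) ℂ) (a : ℕ) :
    Matrix (Fin m) (Fin n) ℂ[X] :=
  (C (1 / 2) : ℂ[X]) •
    ((if a = 0 then (2 * X : ℂ[X]) • const (P k) else 0)
      + const (P (k - 1 - a))
      + (if a = k - 1 then const (P 0) else 0)
      - (if 1 ≤ a then const (P (k + 1 - a)) else 0)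
      - (if a = 1 then const (P k) else 0))

/-- Block `(a, b)`, with `0 ≤ a ≤ k - 1 - ε` and `0 ≤ b ≤ ε`, of the body in all other cases.
For `1 ≤ ε ≤ k - 2` this is the array with
first block column `2λ P_k + P_{k-1}, P_{k-2} - P_k, P_{k-3}, …, P_ε`,
second block column `-P_k, -P_{k-1}, …, -P_{ε+2}, P_{ε-1} - P_{ε+1}`,
last block row `P_ε, P_{ε-1} - P_{ε+1}, P_{ε-2}, …, P_0` and zeros elsewhere
(for `ε = k - 2` the last block row starts with `P_ε - P_{ε+2}`, as in its second row).
For `ε = k - 1 ≥ 1` it is the block row, and for `ε = 0` the block column, with the blocks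
`2λ P_k + P_{k-1}, P_{k-2} - P_k, P_{k-3}, …, P_0`. -/
def bodyBlockGeneral {m n : ℕ} (k ε : ℕ) (P : ℕ → Matrix (Fin m) (Fin n) ℂ) (a b : ℕ) :
    Matrix (Fin m) (Fin n) ℂ[X] :=
  (if a = 0 ∧ b = 0 then (2 * X : ℂ[X]) • const (P k) else 0)
    + (if b = 0 then const (P (k - 1 - a)) else 0)
    - (if a = 1 ∧ b = 0 then const (P k) else 0)
    - (if b = 1 then const (P (k - a)) else 0)
    + (if a = k - 1 - ε ∧ 1 ≤ b then const (P (ε - b)) else 0)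

/-- Block `(a, b)` of the body `M_ε`. -/
def bodyBlock {m n : ℕ} (r : Kind) (k ε : ℕ) (P : ℕ → Matrix (Fin m) (Fin n) ℂ) (a b : ℕ) :
    Matrix (Fin m) (Fin n) ℂ[X] :=
  match r with
  | Kind.first => if ε = 0 then bodyBlockZeroFirst k P a else bodyBlockGeneral k ε P a b
  | Kind.second => bodyBlockGeneral k ε P a b

/-- The body `M_ε`, with `k - ε` block rows (written `k - 1 - ε + 1`) and `ε + 1` block columns. -/
def body {m n : ℕ} (r : Kind) (k ε : ℕ) (P : ℕ → Matrix (Fin m) (Fin n) ℂ) :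
    Matrix (Fin (k - 1 - ε + 1) × Fin m) (Fin (ε + 1) × Fin n) ℂ[X] :=
  Matrix.of fun x y => bodyBlock r k ε P x.1.val y.1.val x.2 y.2

/-- `K₁`: an `ε n × (ε + 1) n` pencil of the same kind as the basis. -/
def K₁ (r : Kind) (ε n : ℕ) : Matrix (Fin ε × Fin n) (Fin (ε + 1) × Fin n) ℂ[X] :=
  chebK r ε n

/-- `K₂`: a `(k - 1 - ε) m × (k - ε) m` pencil, of the second kind whatever the basis. -/
def K₂ (k ε m : ℕ) :
    Matrix (Fin (k - 1 - ε) × Fin m) (Fin (k - 1 - ε + 1) × Fin m) ℂ[X] :=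
  chebK Kind.second (k - 1 - ε) m

/-- The body `M_ε + A K₁ + K₂ᵀ B`. -/
def bodyAB {m n : ℕ} (r : Kind) (k ε : ℕ) (P : ℕ → Matrix (Fin m) (Fin n) ℂ)
    (A : Matrix (Fin (k - 1 - ε + 1) × Fin m) (Fin ε × Fin n) ℂ)
    (B : Matrix (Fin (k - 1 - ε) × Fin m) (Fin (ε + 1) × Fin n) ℂ) :
    Matrix (Fin (k - 1 - ε + 1) × Fin m) (Fin (ε + 1) × Fin n) ℂ[X] :=
  body r k ε P + const A * K₁ r ε n + (K₂ k ε m).transpose * const B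

end

end ChebPencil

namespace ChebPencil

noncomputable section

/-! Put `L = k - 1 - ε`. By the three-term recurrence the block rows `N₁ = [φ_ε I, …, φ_0 I]` and
`N₂ = [U_L I, …, U_0 I]` satisfy `K₁ N₁ᵀ = 0` and `K₂ N₂ᵀ = 0`. If each `Kᵢ` can be completed to a
unimodular matrix whose inverse contains `Nᵢᵀ`, block elimination reduces `[M, K₂ᵀ; K₁, 0]` to `diag
(I, N₂ M N₁ᵀ)` for every body `M` (`isLinearization_blockPencil`). The terms `A K₁` and `K₂ᵀ B`
disappear from `N₂ M N₁ᵀ`, so all that depends on the body is `N₂ M_ε N₁ᵀ = P`. This rests on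
`φ_{ε+j+1} = U_{j+1} φ_ε - U_j φ_{ε-1}` (`phi_second_mul_phi`, `sum_bodyBlockGeneral`), which
explains why `K₂` is of the second kind for both bases; for `ε = 0` and the first kind it rests on
`2 T_{j+2} = U_{j+2} - U_j` (`sum_bodyBlockZeroFirst`).

The reversed pencil has the same block form and the grades `L + 1 + ε = k` add up, so the same
elimination applies once the reversed `Kᵢ` are completed. Both completions come from
`exists_scalar_complement`, with diagonal entry `1` for `Kᵢ` and `X` for its reversal.

Minimality follows from right invertibility together with a lower bound on the degrees of polynomial
combinations of the rows (`isMinimalBasis_of_mul_eq_one`). -/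

/-! ### Unimodular completions and block elimination -/

/-- `K` is completed by some rows `E` to an invertible matrix whose inverse is `[W, Nᵀ]`. -/
def HasComplement {ρ σ κ : Type*} [Fintype κ] [DecidableEq ρ] [DecidableEq σ]
    (K : Matrix ρ κ ℂ[X]) (N : Matrix σ κ ℂ[X]) : Prop :=
  ∃ (E : Matrix σ κ ℂ[X]) (W : Matrix κ ρ ℂ[X]),
    K * W = 1 ∧ E * W = 0 ∧ K * N.transpose = 0 ∧ E * N.transpose = 1

lemma isUnimodular_of_mul_eq_one {ι : Type*} [Fintype ι] [DecidableEq ι] {U V : Matrix ι ι ℂ[X]}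
    (h : U * V = 1) : IsUnimodular U := by
  have h1 : IsUnit U.det := by
    refine IsUnit.of_mul_eq_one V.det ?_
    rw [← Matrix.det_mul, h, Matrix.det_one]
  obtain ⟨c, hc, h2⟩ := Polynomial.isUnit_iff.1 h1
  exact ⟨c, hc.ne_zero, h2.symm⟩

/-- A pencil is a linearization of `P` if it is equivalent to `diag (1, P)` through rectangularly
indexed unimodular matrices. -/
lemma isLinearization_of_equivalence {ρ κ σ : Type*} [Fintype ρ] [Fintype κ] [Fintype σ]
    [DecidableEq ρ] [DecidableEq κ] [DecidableEq σ] {m n : ℕ} {L : Matrix ρ κ ℂ[X]}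
    {P : Matrix (Fin m) (Fin n) ℂ[X]} (hL : IsPencil L)
    (hρ : Fintype.card ρ = Fintype.card σ + m) (hκ : Fintype.card κ = Fintype.card σ + n)
    {U : Matrix (σ ⊕ Fin m) ρ ℂ[X]} {U' : Matrix ρ (σ ⊕ Fin m) ℂ[X]} (hU : U * U' = 1)
    {V : Matrix κ (σ ⊕ Fin n) ℂ[X]} {V' : Matrix (σ ⊕ Fin n) κ ℂ[X]} (hV : V' * V = 1)
    (h : U * L * V = Matrix.fromBlocks 1 0 0 P) : IsLinearization L P := by
  -- Any numbering will do: `U` and `V` absorb the permutations.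
  let e₁ : ρ ≃ Fin (Fintype.card σ) ⊕ Fin m := Fintype.equivOfCardEq (by simp [hρ])
  let e₂ : κ ≃ Fin (Fintype.card σ) ⊕ Fin n := Fintype.equivOfCardEq (by simp [hκ])
  refine ⟨hL, Fintype.card σ, e₁, e₂, ?_⟩
  let f₁ : Fin (Fintype.card σ) ⊕ Fin m ≃ σ ⊕ Fin m :=
    Equiv.sumCongr (Fintype.equivFin σ).symm (Equiv.refl _)
  let f₂ : Fin (Fintype.card σ) ⊕ Fin n ≃ σ ⊕ Fin n :=
    Equiv.sumCongr (Fintype.equivFin σ).symm (Equiv.refl _)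
  refine ⟨U.submatrix f₁ e₁.symm, V.submatrix e₂.symm f₂, ?_, ?_, ?_⟩
  · refine isUnimodular_of_mul_eq_one (V := U'.submatrix e₁.symm f₁) ?_
    rw [Matrix.submatrix_mul_equiv, hU, Matrix.submatrix_one_equiv]
  · refine isUnimodular_of_mul_eq_one (V := V'.submatrix f₂ e₂.symm) (mul_eq_one_comm.1 ?_)
    rw [Matrix.submatrix_mul_equiv, hV, Matrix.submatrix_one_equiv]
  · rw [Matrix.reindex_apply, Matrix.submatrix_mul_equiv, Matrix.submatrix_mul_equiv, h]
    ext (i | i) (j | j) <;> simp [f₁, f₂, Matrix.one_apply]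

/-- Block elimination turns `[M, K₂ᵀ; K₁, 0]` into `diag (1, N₂ M N₁ᵀ)`. -/
lemma isLinearization_blockPencil {ρ₁ κ₁ ρ₂ κ₂ : Type*} [Fintype ρ₁] [Fintype κ₁] [Fintype ρ₂]
    [Fintype κ₂] [DecidableEq ρ₁] [DecidableEq κ₁] [DecidableEq ρ₂] [DecidableEq κ₂] {m n : ℕ}
    {M : Matrix κ₂ κ₁ ℂ[X]} {K₁ : Matrix ρ₁ κ₁ ℂ[X]} {K₂ : Matrix ρ₂ κ₂ ℂ[X]}
    {N₁ : Matrix (Fin n) κ₁ ℂ[X]} {N₂ : Matrix (Fin m) κ₂ ℂ[X]}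
    (hL : IsPencil (blockPencil M K₁ K₂))
    (h₁ : HasComplement K₁ N₁) (h₂ : HasComplement K₂ N₂)
    (hc₁ : Fintype.card κ₁ = Fintype.card ρ₁ + n) (hc₂ : Fintype.card κ₂ = Fintype.card ρ₂ + m) :
    IsLinearization (blockPencil M K₁ K₂) (N₂ * M * N₁.transpose) := by
  obtain ⟨E₁, W₁, a₁, b₁, c₁, d₁⟩ := h₁
  obtain ⟨E₂, W₂, a₂, b₂, c₂, d₂⟩ := h₂
  have a₂' : W₂.transpose * K₂.transpose = 1 := by simpa using congrArg Matrix.transpose a₂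
  have b₂' : W₂.transpose * E₂.transpose = 0 := by simpa using congrArg Matrix.transpose b₂
  have c₂' : N₂ * K₂.transpose = 0 := by simpa using congrArg Matrix.transpose c₂
  have d₂' : N₂ * E₂.transpose = 1 := by simpa using congrArg Matrix.transpose d₂
  -- The identity blocks come from `W₂ᵀ K₂ᵀ = 1` and `K₁ W₁ = 1`. The row `N₂` kills `K₂ᵀ`, and the
  -- products with `M` in `U` and `V` clear the remaining blocks beside the two identities.
  refine isLinearization_of_equivalence (σ := ρ₂ ⊕ ρ₁) hL
    (by simp only [Fintype.card_sum]; omega) (by simp only [Fintype.card_sum]; omega)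
    (U := Matrix.fromRows (Matrix.fromBlocks W₂.transpose 0 0 1)
      (Matrix.fromCols N₂ (-(N₂ * M * W₁))))
    (U' := Matrix.fromCols
      (Matrix.fromBlocks K₂.transpose (E₂.transpose * (N₂ * M * W₁)) 0 1)
      (Matrix.fromRows E₂.transpose 0))
    (V := Matrix.fromCols (Matrix.fromBlocks 0 W₁ 1 (-(W₂.transpose * M * W₁)))
      (Matrix.fromRows N₁.transpose (-(W₂.transpose * M * N₁.transpose))))
    (V' := Matrix.fromRows (Matrix.fromBlocks (W₂.transpose * M) 1 K₁ 0)
      (Matrix.fromCols E₁ 0)) ?_ ?_ ?_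
  · rw [Matrix.fromRows_mul_fromCols, Matrix.fromBlocks_multiply, Matrix.fromBlocks_mul_fromRows,
      Matrix.fromCols_mul_fromBlocks, Matrix.fromCols_mul_fromRows]
    simp [a₂', c₂', d₂', b₂', ← Matrix.mul_assoc]
  · rw [Matrix.fromRows_mul_fromCols, Matrix.fromBlocks_multiply, Matrix.fromBlocks_mul_fromRows,
      Matrix.fromCols_mul_fromBlocks, Matrix.fromCols_mul_fromRows]
    simp [a₁, b₁, c₁, d₁]
  · rw [blockPencil, Matrix.fromRows_mul, Matrix.fromBlocks_multiply,
      Matrix.fromCols_mul_fromBlocks,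
      Matrix.fromRows_mul_fromCols, Matrix.fromBlocks_multiply, Matrix.fromBlocks_mul_fromRows,
      Matrix.fromCols_mul_fromBlocks, Matrix.fromCols_mul_fromRows]
    simp [a₁, c₁, a₂', c₂', Matrix.add_mul, Matrix.mul_assoc]

/-! ### Completion of the scalar pencils and passage to blocks -/

/-- A `q × (q + 1)` matrix whose leading square part is triangular with diagonal entries `t` is
completed to an invertible matrix by a row built from a Bézout relation for a kernel vector `ν`. -/
lemma exists_scalar_complement {q : ℕ} (K : Matrix (Fin q) (Fin (q + 1)) ℂ[X])
    (ν : Fin (q + 1) → ℂ[X]) (t : ℂ[X]) (ht : t ≠ 0)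
    (hdiag : ∀ i, K i i.castSucc = t) (htri : ∀ i j : Fin q, j < i → K i j.castSucc = 0)
    (hker : ∀ i, ∑ j, K i j * ν j = 0) (hlast : ν (Fin.last q) = t ^ q)
    (hco : IsCoprime (ν 0) (t ^ q)) :
    ∃ (e : Fin (q + 1) → ℂ[X]) (w : Matrix (Fin (q + 1)) (Fin q) ℂ[X]),
      (∀ i j, ∑ x, K i x * w x j = if i = j then 1 else 0) ∧
      (∀ j, ∑ x, e x * w x j = 0) ∧ ∑ x, e x * ν x = 1 := by
  obtain ⟨u, v, huv⟩ := hco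
  -- The Bézout coefficients stand at the two ends. For `q = 0` the ends coincide and the entries
  -- add up, so `e · ν = 1` still holds.
  let e : Fin (q + 1) → ℂ[X] :=
    fun j => (if j = 0 then u else 0) + (if j = Fin.last q then v else 0)
  have he : ∑ x, e x * ν x = 1 := by
    simp [e, add_mul, Finset.sum_add_distrib, hlast, huv]
  let f : Fin q ⊕ Fin 1 ≃ Fin (q + 1) := finSumFinEquiv
  let T : Matrix (Fin q ⊕ Fin 1) (Fin q ⊕ Fin 1) ℂ[X] :=
    (Matrix.fromRows K (Matrix.of fun _ j => e j)).submatrix id f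
  let S : Matrix (Fin q ⊕ Fin 1) (Fin q ⊕ Fin 1) ℂ[X] :=
    Matrix.fromBlocks 1 (Matrix.of fun i _ => ν i.castSucc) 0 (Matrix.of fun _ _ => t ^ q)
  have hinl : ∀ i : Fin q, f (Sum.inl i) = i.castSucc := fun i => rfl
  have hinr : ∀ i : Fin 1, f (Sum.inr i) = Fin.last q := fun i => by
    rw [Subsingleton.elim i 0]; rfl
  have hTS : T * S = Matrix.fromBlocks (K.submatrix id Fin.castSucc) 0
      (Matrix.of fun _ j => e j.castSucc) 1 := by
    rw [Fin.sum_univ_castSucc] at he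
    ext (i | i) (j | j)
    · simp [T, S, Matrix.mul_apply, hinl, Matrix.one_apply]
    · have := hker i
      rw [Fin.sum_univ_castSucc] at this
      simp [T, S, Matrix.mul_apply, hinl, hinr, ← hlast, this]
    · simp [T, S, Matrix.mul_apply, hinl, Matrix.one_apply]
    · simp [T, S, Matrix.mul_apply, hinl, hinr, ← hlast, he,
        Subsingleton.elim i j]
  have hK' : (K.submatrix id Fin.castSucc).det = t ^ q := by
    rw [Matrix.det_of_isUpperTriangular]
    · simp [hdiag]
    · intro i j hij
      exact htri i j hij
  have hdet : T.det = 1 := by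
    -- Both `S` and the triangular part of `K` have determinant `t ^ q`. Cancelling it gives `det T
    -- = 1` even though `t` need not be a unit, and the adjugate is then the inverse.
    have h1 : T.det * t ^ q = t ^ q := by
      have := congrArg Matrix.det hTS
      rw [Matrix.det_mul, Matrix.det_fromBlocks_zero₁₂, hK'] at this
      simpa [S, Matrix.det_fromBlocks_zero₂₁] using this
    exact mul_right_cancel₀ (pow_ne_zero q ht) (h1.trans (one_mul _).symm)
  have hT : T * T.adjugate = 1 := by rw [Matrix.mul_adjugate, hdet, one_smul]
  refine ⟨e, Matrix.of fun x j => T.adjugate (f.symm x) (Sum.inl j), fun i j => ?_, fun j => ?_, he⟩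
  · have := congrFun (congrFun hT (Sum.inl i)) (Sum.inl j)
    rw [Matrix.mul_apply] at this
    rw [← f.sum_comp]
    simpa [T, Matrix.one_apply] using this
  · have := congrFun (congrFun hT (Sum.inr 0)) (Sum.inl j)
    rw [Matrix.mul_apply] at this
    rw [← f.sum_comp]
    simpa [T, Matrix.one_apply] using this

/-- The block row `[ν₀ I, ν₁ I, …]` with blocks of size `n × n`. -/
def scalarRow {β : Type*} (n : ℕ) (ν : β → ℂ[X]) : Matrix (Fin n) (β × Fin n) ℂ[X] :=
  Matrix.of fun i y => if i = y.2 then ν y.1 else 0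

/-- The block matrix with the blocks `K a b • I` of size `n × n`. -/
def scalarBlocks {α β : Type*} (n : ℕ) (K : Matrix α β ℂ[X]) :
    Matrix (α × Fin n) (β × Fin n) ℂ[X] :=
  Matrix.of fun x y => if x.2 = y.2 then K x.1 y.1 else 0

lemma hasComplement_scalarBlocks {q : ℕ} (n : ℕ) (K : Matrix (Fin q) (Fin (q + 1)) ℂ[X])
    (ν : Fin (q + 1) → ℂ[X]) (t : ℂ[X]) (ht : t ≠ 0)
    (hdiag : ∀ i, K i i.castSucc = t) (htri : ∀ i j : Fin q, j < i → K i j.castSucc = 0)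
    (hker : ∀ i, ∑ j, K i j * ν j = 0) (hlast : ν (Fin.last q) = t ^ q)
    (hco : IsCoprime (ν 0) (t ^ q)) :
    HasComplement (scalarBlocks n K) (scalarRow n ν) := by
  obtain ⟨e, w, h1, h2, h3⟩ := exists_scalar_complement K ν t ht hdiag htri hker hlast hco
  refine ⟨scalarRow n e, scalarBlocks n w, ?_, ?_, ?_, ?_⟩
  · ext ⟨a, i⟩ ⟨b, j⟩
    by_cases hij : i = j
    · subst hij
      simp [Matrix.mul_apply, scalarBlocks, Fintype.sum_prod_type, h1, Matrix.one_apply]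
    · simp [Matrix.mul_apply, scalarBlocks, Fintype.sum_prod_type, hij]
  · ext i ⟨b, j⟩
    by_cases hij : i = j
    · subst hij
      simp [Matrix.mul_apply, scalarBlocks, scalarRow, Fintype.sum_prod_type, h2]
    · simp [Matrix.mul_apply, scalarBlocks, scalarRow, Fintype.sum_prod_type, hij]
  · ext ⟨a, i⟩ j
    by_cases hij : i = j
    · subst hij
      simp [Matrix.mul_apply, scalarBlocks, scalarRow, Fintype.sum_prod_type, hker]
    · simp [Matrix.mul_apply, scalarBlocks, scalarRow, Fintype.sum_prod_type, hij]
  · ext i j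
    by_cases hij : i = j
    · subst hij
      simp [Matrix.mul_apply, scalarRow, Fintype.sum_prod_type, h3]
    · simp [Matrix.mul_apply, scalarRow, Fintype.sum_prod_type, hij]

/-! ### A criterion for minimal bases -/

lemma natDegree_le_rowDegree {ρ κ : Type*} [Fintype κ] (K : Matrix ρ κ ℂ[X]) (i : ρ) (j : κ) :
    (K i j).natDegree ≤ rowDegree K i :=
  Finset.le_sup (f := fun j => (K i j).natDegree) (Finset.mem_univ j)

/-- A right invertible matrix polynomial with all row degrees at most `d` is a minimal basis if all
nonzero polynomial combinations of its rows have degree at least `d`. -/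
lemma isMinimalBasis_of_mul_eq_one {ρ κ : Type*} [Fintype ρ] [Fintype κ] [DecidableEq ρ]
    {K : Matrix ρ κ ℂ[X]} {W : Matrix κ ρ ℂ[X]} (hW : K * W = 1) {d : ℕ}
    (hd : ∀ i, rowDegree K i ≤ d)
    (hp : ∀ p : ρ → ℂ[X], p ≠ 0 → ∃ j, d ≤ (∑ i, p i * K i j).natDegree) :
    IsMinimalBasis K := by
  let φ := algebraMap ℂ[X] (RatFunc ℂ)
  have hφ : Function.Injective φ := IsFractionRing.injective ℂ[X] (RatFunc ℂ)
  -- The right inverse recovers the coefficients of a combination, so a polynomial vector in the row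
  -- space has polynomial coefficients. Each row of a competing basis is thus a nonzero polynomial
  -- combination of the rows of `K`, and has degree at least `d`.
  have key : ∀ (c : ρ → RatFunc ℂ) (v : κ → RatFunc ℂ), ∑ i, c i • ratRow K i = v →
      ∀ i, c i = ∑ j, v j * φ (W j i) := by
    rintro c _ rfl i
    have hW' : ∀ a, ∑ j, φ (K a j) * φ (W j i) = if a = i then 1 else 0 := by
      intro a
      have := congrArg φ (congrFun (congrFun hW a) i)
      rw [Matrix.mul_apply, Matrix.one_apply, map_sum] at this
      simpa [apply_ite φ] using this
    simp only [Finset.sum_apply, Pi.smul_apply, smul_eq_mul, Finset.sum_mul, ratRow]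
    rw [Finset.sum_comm]
    have h1 : ∀ a, ∑ j, c a * φ (K a j) * φ (W j i) = c a * if a = i then 1 else 0 := by
      intro a
      rw [← hW', Finset.mul_sum]
      exact Finset.sum_congr rfl fun _ _ => mul_assoc _ _ _
    rw [Finset.sum_congr rfl fun a _ => h1 a]
    simp
  refine ⟨?_, fun Q hQ hspan => ?_⟩
  · rw [Fintype.linearIndependent_iff]
    intro g hg i
    simpa using key g 0 hg i
  · refine Finset.sum_le_sum fun i _ => (hd i).trans ?_
    have hmem : ratRow Q i ∈ rowSpan K := by
      rw [← hspan]
      exact Submodule.subset_span ⟨i, rfl⟩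
    obtain ⟨c, hc⟩ := (Submodule.mem_span_range_iff_exists_fun _).1 hmem
    let p : ρ → ℂ[X] := fun a => ∑ j, Q i j * W j a
    have hcp : ∀ a, c a = φ (p a) := by
      intro a
      rw [key c _ hc a, map_sum]
      exact Finset.sum_congr rfl fun j _ => (map_mul φ _ _).symm
    have hQp : ∀ j, ∑ a, p a * K a j = Q i j := by
      intro j
      apply hφ
      have := congrFun hc j
      simp only [Finset.sum_apply, Pi.smul_apply, smul_eq_mul, ratRow, hcp] at this
      rw [map_sum]
      exact (Finset.sum_congr rfl fun a _ => map_mul φ _ _).trans this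
    have hp0 : p ≠ 0 := by
      intro h0
      apply hQ.ne_zero i
      ext1 j
      simp only [ratRow, ← hQp j, h0]
      simp
    obtain ⟨j, hj⟩ := hp p hp0
    rw [hQp] at hj
    exact hj.trans (natDegree_le_rowDegree Q i j)

/-! ### Grades and reversals -/

lemma reflect_sum {ι : Type*} (s : Finset ι) (f : ι → ℂ[X]) (N : ℕ) :
    reflect N (∑ i ∈ s, f i) = ∑ i ∈ s, reflect N (f i) :=
  map_sum (AddMonoidHom.mk' (reflect N) fun a b => reflect_add a b N) f s

lemma rev_mul {ρ κ τ : Type*} [Fintype κ] {a b : ℕ} {A : Matrix ρ κ ℂ[X]} {B : Matrix κ τ ℂ[X]}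
    (hA : HasGrade a A) (hB : HasGrade b B) : rev (a + b) (A * B) = rev a A * rev b B := by
  ext1 i j
  simp only [rev, Matrix.map_apply, Matrix.mul_apply, reflect_sum]
  exact Finset.sum_congr rfl fun x _ => reflect_mul _ _ (hA i x) (hB x j)

lemma HasGrade.mul {ρ κ τ : Type*} [Fintype κ] {a b : ℕ} {A : Matrix ρ κ ℂ[X]}
    {B : Matrix κ τ ℂ[X]} (hA : HasGrade a A) (hB : HasGrade b B) : HasGrade (a + b) (A * B) :=
  fun i j => natDegree_sum_le_of_forall_le _ _ fun x _ =>
    natDegree_mul_le.trans (Nat.add_le_add (hA i x) (hB x j))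

lemma HasGrade.transpose {ρ κ : Type*} {a : ℕ} {A : Matrix ρ κ ℂ[X]} (hA : HasGrade a A) :
    HasGrade a A.transpose :=
  fun i j => hA j i

lemma HasGrade.add {ρ κ : Type*} {a : ℕ} {A B : Matrix ρ κ ℂ[X]} (hA : HasGrade a A)
    (hB : HasGrade a B) : HasGrade a (A + B) :=
  fun i j => natDegree_add_le_of_degree_le (hA i j) (hB i j)

lemma HasGrade.sub {ρ κ : Type*} {a : ℕ} {A B : Matrix ρ κ ℂ[X]} (hA : HasGrade a A)
    (hB : HasGrade a B) : HasGrade a (A - B) :=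
  fun i j => (natDegree_sub_le_of_le (hA i j) (hB i j)).trans (max_self a).le

lemma HasGrade.ite {ρ κ : Type*} {a : ℕ} {A : Matrix ρ κ ℂ[X]} (c : Prop) [Decidable c]
    (hA : HasGrade a A) : HasGrade a (if c then A else 0) := by
  split_ifs
  · exact hA
  · intro i j
    simp

lemma hasGrade_const {ρ κ : Type*} (a : ℕ) (A : Matrix ρ κ ℂ) : HasGrade a (const A) :=
  fun i j => by simp [const]

lemma HasGrade.smul {ρ κ : Type*} {a b c : ℕ} {A : Matrix ρ κ ℂ[X]} {f : ℂ[X]}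
    (hf : f.natDegree ≤ b) (hA : HasGrade c A) (h : b + c ≤ a) : HasGrade a (f • A) :=
  fun i j => natDegree_mul_le.trans ((Nat.add_le_add hf (hA i j)).trans h)

lemma HasGrade.rev {ρ κ : Type*} {k : ℕ} {A : Matrix ρ κ ℂ[X]} (hA : HasGrade k A) :
    HasGrade k (rev k A) :=
  fun i j => natDegree_reflect_le.trans (max_le le_rfl (hA i j))

lemma hasGrade_blockPencil {ρ₁ κ₁ ρ₂ κ₂ : Type*} {M : Matrix κ₂ κ₁ ℂ[X]} {K₁ : Matrix ρ₁ κ₁ ℂ[X]}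
    {K₂ : Matrix ρ₂ κ₂ ℂ[X]} (hM : HasGrade 1 M) (h₁ : HasGrade 1 K₁) (h₂ : HasGrade 1 K₂) :
    IsPencil (blockPencil M K₁ K₂) := by
  rintro (i | i) (j | j)
  · exact hM i j
  · exact h₂ j i
  · exact h₁ i j
  · simp [blockPencil]

lemma rev_blockPencil {ρ₁ κ₁ ρ₂ κ₂ : Type*} (M : Matrix κ₂ κ₁ ℂ[X]) (K₁ : Matrix ρ₁ κ₁ ℂ[X])
    (K₂ : Matrix ρ₂ κ₂ ℂ[X]) (k : ℕ) :
    rev k (blockPencil M K₁ K₂) = blockPencil (rev k M) (rev k K₁) (rev k K₂) := by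
  ext (i | i) (j | j) <;> simp [rev, blockPencil]

lemma hasGrade_scalarBlocks {α β : Type*} [Fintype β] {n d : ℕ} {K : Matrix α β ℂ[X]}
    (h : HasGrade d K) : HasGrade d (scalarBlocks n K) := by
  rintro ⟨a, i⟩ ⟨b, j⟩
  simp only [scalarBlocks, Matrix.of_apply]
  split_ifs
  · exact h a b
  · simp

lemma rowDegree_le {ρ κ : Type*} [Fintype κ] {d : ℕ} {K : Matrix ρ κ ℂ[X]} (h : HasGrade d K)
    (i : ρ) : rowDegree K i ≤ d :=
  Finset.sup_le fun j _ => h i j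

lemma rev_scalarBlocks {α β : Type*} (n k : ℕ) (K : Matrix α β ℂ[X]) :
    rev k (scalarBlocks n K) = scalarBlocks n (rev k K) := by
  ext1 x y
  simp only [rev, scalarBlocks, Matrix.map_apply, Matrix.of_apply, apply_ite (reflect k),
    reflect_zero]

lemma rev_scalarRow {β : Type*} (n k : ℕ) (ν : β → ℂ[X]) :
    rev k (scalarRow n ν) = scalarRow n fun b => reflect k (ν b) := by
  ext1 x y
  simp only [rev, scalarRow, Matrix.map_apply, Matrix.of_apply, apply_ite (reflect k),
    reflect_zero]

/-! ### Chebyshev recurrences and completion of the Chebyshev pencils -/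

lemma phi_zero (r : Kind) : phi r 0 = 1 := by
  cases r <;> simp [phi]

lemma phi_add_two (r : Kind) (i : ℕ) : phi r (i + 2) = 2 * X * phi r (i + 1) - phi r i := by
  cases r
  · exact Chebyshev.T_add_two ℂ i
  · exact Chebyshev.U_add_two ℂ i

lemma natDegree_phi (r : Kind) (i : ℕ) : (phi r i).natDegree = i := by
  cases r
  · simp [phi, Chebyshev.natDegree_T]
  · simp [phi, Chebyshev.natDegree_U_natCast]

lemma phi_ne_zero (r : Kind) (i : ℕ) : phi r i ≠ 0 := by
  cases r
  · exact Chebyshev.T_ne_zero ℂ i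
  · exact Chebyshev.U_ne_zero ℂ i (by omega)

lemma exists_phi_one (r : Kind) : ∃ c : ℂ, c ≠ 0 ∧ phi r 1 = C c * X := by
  cases r
  · exact ⟨1, one_ne_zero, by simp [phi]⟩
  · exact ⟨2, two_ne_zero, by simp [phi, show (C 2 : ℂ[X]) = 2 from rfl]⟩

/-- `chebK` for blocks of size `1 × 1`. -/
def chebScalar (r : Kind) (q : ℕ) : Matrix (Fin q) (Fin (q + 1)) ℂ[X] :=
  Matrix.of fun a b =>
    if b.val = a.val then 1
    else if b.val = a.val + 1 then (if a.val + 1 = q then -phi r 1 else -(2 * X))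
    else if b.val = a.val + 2 then 1
    else 0

/-- The vector `φ_q, …, φ_0`. -/
def phiVec (r : Kind) (q : ℕ) (j : Fin (q + 1)) : ℂ[X] :=
  phi r (q - j)

lemma chebK_eq (r : Kind) (q n : ℕ) : chebK r q n = scalarBlocks n (chebScalar r q) := rfl

/-- This is the only nonconstant entry of its row and of its column, which yields both the row
degrees and the minimality of the pencil. -/
lemma exists_chebScalar_succ (r : Kind) {q : ℕ} (a : Fin q) :
    ∃ c : ℂ, c ≠ 0 ∧ chebScalar r q a a.succ = C c * X := by
  obtain ⟨c, hc, h⟩ := exists_phi_one r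
  by_cases haq : a.val + 1 = q
  · exact ⟨-c, neg_ne_zero.2 hc, by
      simp only [chebScalar, Matrix.of_apply, Fin.val_succ, haq, if_true]
      rw [if_neg (by omega), h, C_neg, neg_mul]⟩
  · exact ⟨-2, by norm_num, by
      simp [chebScalar, haq, show (C 2 : ℂ[X]) = 2 from rfl]⟩

lemma natDegree_chebScalar_of_ne (r : Kind) {q : ℕ} (a : Fin q) (b : Fin (q + 1))
    (h : b ≠ a.succ) : (chebScalar r q a b).natDegree = 0 := by
  have : b.val ≠ a.val + 1 := fun h' => h (Fin.ext (by simpa using h'))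
  simp only [chebScalar, Matrix.of_apply, this, if_false]
  split_ifs <;> simp

lemma hasGrade_chebScalar (r : Kind) (q : ℕ) : HasGrade 1 (chebScalar r q) := by
  intro a b
  by_cases h : b = a.succ
  · obtain ⟨c, hc, h'⟩ := exists_chebScalar_succ r a
    rw [h, h']
    rw [natDegree_C_mul_X c hc]
  · rw [natDegree_chebScalar_of_ne r a b h]
    exact zero_le_one

lemma chebScalar_mul_phiVec (r : Kind) (q : ℕ) (a : Fin q) :
    ∑ j, chebScalar r q a j * phiVec r q j = 0 := by
  obtain ⟨a, ha⟩ := a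
  have h1 : ∀ j : Fin (q + 1), chebScalar r q ⟨a, ha⟩ j * phiVec r q j =
      (fun j : ℕ => (if j = a then phi r (q - j) else 0) +
        (if j = a + 1 then (if a + 1 = q then -phi r 1 else -(2 * X)) * phi r (q - j) else 0) +
        (if j = a + 2 then phi r (q - j) else 0)) j := by
    rintro ⟨j, hj⟩
    simp only [chebScalar, phiVec, Matrix.of_apply]
    by_cases h1 : j = a
    · simp [h1]
    by_cases h2 : j = a + 1
    · simp [h2]
    by_cases h3 : j = a + 2
    · simp [h3]
    · simp [h1, h2, h3]
  rw [Finset.sum_congr rfl fun j _ => h1 j, Fin.sum_univ_eq_sum_range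
    (fun j : ℕ => (if j = a then phi r (q - j) else 0) +
        (if j = a + 1 then (if a + 1 = q then -phi r 1 else -(2 * X)) * phi r (q - j) else 0) +
        (if j = a + 2 then phi r (q - j) else 0))]
  simp only [Finset.sum_add_distrib, Finset.sum_ite_eq', Finset.mem_range]
  rw [if_pos (by omega), if_pos (by omega)]
  by_cases haq : a + 1 = q
  · subst haq
    simp [phi_zero]
  · obtain ⟨l, rfl⟩ : ∃ l, q = a + l + 2 := ⟨q - a - 2, by omega⟩
    rw [if_neg haq, if_pos (by omega), show a + l + 2 - a = l + 2 by omega,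
      show a + l + 2 - (a + 1) = l + 1 by omega, show a + l + 2 - (a + 2) = l by omega,
      phi_add_two]
    ring

lemma chebScalar_triangular (r : Kind) {q : ℕ} (i j : Fin q) (h : j < i) :
    chebScalar r q i j.castSucc = 0 := by
  have h' : j.val < i.val := h
  simp only [chebScalar, Matrix.of_apply, Fin.val_castSucc]
  rw [if_neg (by omega), if_neg (by omega), if_neg (by omega)]

lemma chebScalar_diagonal (r : Kind) {q : ℕ} (i : Fin q) : chebScalar r q i i.castSucc = 1 := by
  simp [chebScalar]

lemma hasComplement_chebK (r : Kind) (q n : ℕ) :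
    HasComplement (chebK r q n) (scalarRow n (phiVec r q)) := by
  rw [chebK_eq]
  refine hasComplement_scalarBlocks n _ _ 1 one_ne_zero (chebScalar_diagonal r)
    (chebScalar_triangular r) (chebScalar_mul_phiVec r q) ?_ ?_
  · simp [phiVec, phi_zero]
  · rw [one_pow]
    exact isCoprime_one_right

lemma natDegree_phiVec_le (r : Kind) (q : ℕ) (j : Fin (q + 1)) : (phiVec r q j).natDegree ≤ q := by
  rw [phiVec, natDegree_phi]
  exact Nat.sub_le _ _

/-- Reversal turns the diagonal `1` into `X` and the last kernel entry `φ_0 = 1` into `X ^ q`. The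
constant term of the reversed `φ_q` is the leading coefficient of `φ_q`, hence nonzero, and this
gives coprimality with `X ^ q`. -/
lemma hasComplement_rev_chebK (r : Kind) (q n : ℕ) :
    HasComplement (rev 1 (chebK r q n)) (rev q (scalarRow n (phiVec r q))) := by
  rw [chebK_eq, rev_scalarBlocks, rev_scalarRow]
  refine hasComplement_scalarBlocks n _ _ X X_ne_zero ?_ ?_ ?_ ?_ ?_
  · intro i
    simp [rev, chebScalar_diagonal]
  · intro i j h
    simp [rev, chebScalar_triangular r i j h]
  · intro i
    have := congrArg (reflect (1 + q)) (chebScalar_mul_phiVec r q i)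
    rw [reflect_sum, reflect_zero] at this
    rw [← this]
    exact Finset.sum_congr rfl fun j _ =>
      (reflect_mul _ _ (hasGrade_chebScalar r q i j) (natDegree_phiVec_le r q j)).symm
  · simp [phiVec, phi_zero]
  · refine IsCoprime.pow_right (IsCoprime.symm ?_)
    rw [irreducible_X.coprime_iff_not_dvd, X_dvd_iff, coeff_reflect, revAt_zero]
    have h : (phiVec r q 0).coeff q = (phi r q).leadingCoeff := by
      simp [phiVec, leadingCoeff, natDegree_phi]
    rw [h, leadingCoeff_eq_zero]
    exact phi_ne_zero r q

/-! ### Minimality of the Chebyshev pencils and of their duals -/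

lemma rowDegree_chebK (r : Kind) (q n : ℕ) (x : Fin q × Fin n) :
    rowDegree (chebK r q n) x = 1 := by
  refine le_antisymm (rowDegree_le (hasGrade_scalarBlocks (hasGrade_chebScalar r q)) x) ?_
  obtain ⟨c, hc, h⟩ := exists_chebScalar_succ r x.1
  have := natDegree_le_rowDegree (chebK r q n) x (x.1.succ, x.2)
  rwa [chebK_eq, scalarBlocks, Matrix.of_apply, if_pos rfl, h, natDegree_C_mul_X c hc] at this

lemma isMinimalBasis_chebK (r : Kind) (q n : ℕ) : IsMinimalBasis (chebK r q n) := by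
  obtain ⟨E, W, hW, -⟩ := hasComplement_chebK r q n
  refine isMinimalBasis_of_mul_eq_one hW (fun i => (rowDegree_chebK r q n i).le) fun p hp => ?_
  obtain ⟨z, hz⟩ := Function.ne_iff.1 hp
  -- For `p x` of maximal degree, look at the column where row `x` has its linear entry. All other
  -- entries there are constant, so the leading term of `X * p x` cannot cancel.
  obtain ⟨x, -, hx⟩ := Finset.exists_max_image Finset.univ (fun x => (p x).degree)
    ⟨z, Finset.mem_univ z⟩
  have hpx : p x ≠ 0 := by
    intro h0
    have := hx z (Finset.mem_univ z)
    rw [h0, degree_zero, le_bot_iff, degree_eq_bot] at this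
    exact hz this
  obtain ⟨c, hc, h⟩ := exists_chebScalar_succ r x.1
  refine ⟨(x.1.succ, x.2), ?_⟩
  suffices hcoeff : (∑ i, p i * chebK r q n i (x.1.succ, x.2)).coeff ((p x).natDegree + 1) ≠ 0 from
    le_trans (Nat.le_add_left 1 _) (le_natDegree_of_ne_zero hcoeff)
  rw [finsetSum_coeff, Finset.sum_eq_single x]
  · rw [chebK_eq, scalarBlocks, Matrix.of_apply, if_pos rfl, h, mul_left_comm, coeff_C_mul,
      coeff_mul_X]
    exact mul_ne_zero hc (leadingCoeff_ne_zero.2 hpx)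
  · intro y _ hy
    refine coeff_eq_zero_of_natDegree_lt (Nat.lt_succ_of_le ?_)
    have h0 : (chebK r q n y (x.1.succ, x.2)).natDegree = 0 := by
      rw [chebK_eq, scalarBlocks, Matrix.of_apply]
      split_ifs with hyx
      · refine natDegree_chebScalar_of_ne r _ _ fun h' => hy (Prod.ext ?_ hyx)
        exact (Fin.succ_injective _ h').symm
      · simp
    refine natDegree_mul_le.trans ?_
    rw [h0, add_zero]
    exact natDegree_le_natDegree (hx y (Finset.mem_univ y))
  · simp

lemma hasGrade_scalarRow_phiVec (r : Kind) (q n : ℕ) :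
    HasGrade q (scalarRow n (phiVec r q)) := by
  rintro i ⟨b, j⟩
  simp only [scalarRow, Matrix.of_apply]
  split_ifs
  · exact natDegree_phiVec_le r q b
  · simp

lemma rowDegree_scalarRow_phiVec (r : Kind) (q n : ℕ) (i : Fin n) :
    rowDegree (scalarRow n (phiVec r q)) i = q := by
  refine le_antisymm (rowDegree_le (hasGrade_scalarRow_phiVec r q n) i) ?_
  have := natDegree_le_rowDegree (scalarRow n (phiVec r q)) i (0, i)
  simpa [scalarRow, phiVec, natDegree_phi] using this

lemma isMinimalBasis_scalarRow_phiVec (r : Kind) (q n : ℕ) :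
    IsMinimalBasis (scalarRow n (phiVec r q)) := by
  obtain ⟨E, -, -, -, -, hE⟩ := hasComplement_chebK r q n
  -- The row completing `K` serves, transposed, as right inverse of the dual basis.
  have hE' : scalarRow n (phiVec r q) * E.transpose = 1 := by
    simpa using congrArg Matrix.transpose hE
  refine isMinimalBasis_of_mul_eq_one hE'
    (fun i => (rowDegree_scalarRow_phiVec r q n i).le) fun p hp => ?_
  obtain ⟨z, hz⟩ := Function.ne_iff.1 hp
  refine ⟨(0, z), ?_⟩
  have : ∑ i, p i * scalarRow n (phiVec r q) i (0, z) = p z * phi r q := by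
    simp [scalarRow, phiVec]
  rw [this, natDegree_mul hz (phi_ne_zero r q), natDegree_phi]
  exact Nat.le_add_left _ _

lemma isStrongMinimalBasis_chebK (r : Kind) (q n : ℕ) : IsStrongMinimalBasis (chebK r q n) := by
  refine ⟨isMinimalBasis_chebK r q n, rowDegree_chebK r q n, q, n, scalarRow n (phiVec r q),
    ⟨isMinimalBasis_chebK r q n, isMinimalBasis_scalarRow_phiVec r q n, ?_, ?_⟩,
    rowDegree_scalarRow_phiVec r q n⟩
  · simp only [Fintype.card_prod, Fintype.card_fin]
    ring
  · obtain ⟨E, W, -, -, h, -⟩ := hasComplement_chebK r q n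
    exact h

/-! ### The scalar identities behind `N₂ M N₁ᵀ = P` -/

/-- The scalar form of `N₂ M N₁ᵀ = P` for the body with first block column, second block column and
last block row. -/
lemma sum_bodyBlockGeneral {R : Type*} [CommRing R] {k L ε : ℕ} (hk : k = L + 1 + ε)
    (u φ p : ℕ → R) (x v : R) (hu0 : u 0 = 1)
    (hu : u (L + 1) = 2 * x * u L - if 1 ≤ L then u (L - 1) else 0)
    (hφ : ∀ j, φ (ε + (j + 1)) = u (j + 1) * φ ε - u j * v)
    (hv : ε ≠ 0 → v = φ (ε - 1)) (hv0 : ε = 0 → v = 0) :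
    ∑ a ∈ Finset.range (L + 1), ∑ b ∈ Finset.range (ε + 1), u (L - a) *
      ((if a = 0 ∧ b = 0 then 2 * x * p k else 0) + (if b = 0 then p (k - 1 - a) else 0)
        - (if a = 1 ∧ b = 0 then p k else 0) - (if b = 1 then p (k - a) else 0)
        + (if a = L ∧ 1 ≤ b then p (ε - b) else 0)) * φ (ε - b)
      = ∑ i ∈ Finset.range (k + 1), φ i * p i := by
  have inner : ∀ a ∈ Finset.range (L + 1), ∑ b ∈ Finset.range (ε + 1), u (L - a) *
      ((if a = 0 ∧ b = 0 then 2 * x * p k else 0) + (if b = 0 then p (k - 1 - a) else 0)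
        - (if a = 1 ∧ b = 0 then p k else 0) - (if b = 1 then p (k - a) else 0)
        + (if a = L ∧ 1 ≤ b then p (ε - b) else 0)) * φ (ε - b)
      = (if a = 0 then u L * (2 * x) * p k * φ ε else 0)
        + u (L - a) * p (ε + (L - a)) * φ ε
        - (if a = 1 then u (L - 1) * p k * φ ε else 0)
        - u (L - a) * p (ε + (L - a + 1)) * v
        + (if a = L then ∑ b ∈ Finset.range ε, φ b * p b else 0) := by
    intro a ha
    have ha' : a < L + 1 := Finset.mem_range.1 ha
    rw [Finset.sum_range_succ', show k - 1 - a = ε + (L - a) by omega,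
      show k - a = ε + (L - a + 1) by omega]
    have hzero : u (L - a) * ((if a = 0 ∧ 0 = 0 then 2 * x * p k else 0)
        + (if 0 = 0 then p (ε + (L - a)) else 0)
        - (if a = 1 ∧ 0 = 0 then p k else 0) - (if 0 = 1 then p (ε + (L - a + 1)) else 0)
        + (if a = L ∧ 1 ≤ 0 then p (ε - 0) else 0)) * φ (ε - 0)
        = (if a = 0 then u L * (2 * x) * p k * φ ε else 0)
        + u (L - a) * p (ε + (L - a)) * φ ε
        - (if a = 1 then u (L - 1) * p k * φ ε else 0) := by
      by_cases h0 : a = 0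
      · subst h0
        simp
        ring
      · by_cases h1 : a = 1
        · subst h1
          simp
          ring
        · simp [h0, h1]
    rw [hzero]
    rcases ε with _ | e
    · simp [hv0 rfl]
    -- Here `b` is shifted by one: `b = 0` is the second block column, whose factor `φ (ε - 1)` is
    -- `v`. The last block row contributes with the factor `u 0 = 1`.
    · have hterm : ∀ b ∈ Finset.range (e + 1), u (L - a) *
          ((if a = 0 ∧ b + 1 = 0 then 2 * x * p k else 0)
          + (if b + 1 = 0 then p (e + 1 + (L - a)) else 0)
          - (if a = 1 ∧ b + 1 = 0 then p k else 0)
          - (if b + 1 = 1 then p (e + 1 + (L - a + 1)) else 0)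
          + (if a = L ∧ 1 ≤ b + 1 then p (e + 1 - (b + 1)) else 0)) * φ (e + 1 - (b + 1))
          = (if b = 0 then -(u (L - a) * p (e + 1 + (L - a + 1)) * v) else 0)
          + (if a = L then φ (e + 1 - 1 - b) * p (e + 1 - 1 - b) else 0) := by
        intro b _
        have hv' := hv (Nat.succ_ne_zero e)
        simp only [Nat.add_sub_cancel] at hv'
        by_cases haL : a = L
        · subst haL
          by_cases hb : b = 0
          · subst hb
            simp [hu0, hv']
            ring
          · simp [hu0, hb]
            ring
        · by_cases hb : b = 0
          · subst hb
            simp [haL, hv']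
          · simp [haL, hb]
      rw [Finset.sum_congr rfl hterm, Finset.sum_add_distrib]
      have hrefl : ∑ b ∈ Finset.range (e + 1),
          (if a = L then φ (e + 1 - 1 - b) * p (e + 1 - 1 - b) else 0)
          = if a = L then ∑ b ∈ Finset.range (e + 1), φ b * p b else 0 := by
        split_ifs
        · exact Finset.sum_range_reflect (fun b => φ b * p b) (e + 1)
        · simp
      rw [hrefl]
      simp
      ring
  rw [Finset.sum_congr rfl inner]
  simp only [Finset.sum_add_distrib, Finset.sum_sub_distrib, Finset.sum_ite_eq',
    Finset.mem_range]
  have h1 : ∑ a ∈ Finset.range (L + 1), u (L - a) * p (ε + (L - a)) * φ ε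
      = p ε * φ ε + ∑ j ∈ Finset.range L, u (j + 1) * p (ε + (j + 1)) * φ ε := by
    rw [← Finset.sum_range_reflect]
    have : ∀ j ∈ Finset.range (L + 1), u (L - (L + 1 - 1 - j)) * p (ε + (L - (L + 1 - 1 - j))) * φ ε
        = u j * p (ε + j) * φ ε := by
      intro j hj
      have := Finset.mem_range.1 hj
      rw [show L - (L + 1 - 1 - j) = j by omega]
    rw [Finset.sum_congr rfl this, Finset.sum_range_succ', hu0]
    simp
    ring
  have h2 : ∑ a ∈ Finset.range (L + 1), u (L - a) * p (ε + (L - a + 1)) * v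
      = ∑ j ∈ Finset.range (L + 1), u j * p (ε + (j + 1)) * v := by
    rw [← Finset.sum_range_reflect]
    refine Finset.sum_congr rfl fun j hj => ?_
    have := Finset.mem_range.1 hj
    rw [show L - (L + 1 - 1 - j) = j by omega]
  -- The terms above `ε` are expanded by `hφ`. The top term `u (L + 1) * p k * φ ε` is what the two
  -- entries `2 * x * p k` and `-p k` of the first block column produce through `hu`.
  have h3 : ∑ i ∈ Finset.range (k + 1), φ i * p i = ∑ i ∈ Finset.range ε, φ i * p i
      + (p ε * φ ε + (∑ j ∈ Finset.range L, u (j + 1) * p (ε + (j + 1)) * φ ε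
        + u (L + 1) * p k * φ ε)
        - ∑ j ∈ Finset.range (L + 1), u j * p (ε + (j + 1)) * v) := by
    have h4 : ∑ j ∈ Finset.range (L + 1), φ (ε + (j + 1)) * p (ε + (j + 1))
        = ∑ j ∈ Finset.range (L + 1), u (j + 1) * p (ε + (j + 1)) * φ ε
          - ∑ j ∈ Finset.range (L + 1), u j * p (ε + (j + 1)) * v := by
      rw [← Finset.sum_sub_distrib]
      refine Finset.sum_congr rfl fun j _ => ?_
      rw [hφ]
      ring
    rw [show k + 1 = ε + (L + 1 + 1) by omega, Finset.sum_range_add, Finset.sum_range_succ', h4,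
      Finset.sum_range_succ (fun j => u (j + 1) * p (ε + (j + 1)) * φ ε),
      show ε + (L + 1) = k by omega]
    simp only [add_zero]
    ring
  rw [h1, h2, h3, hu]
  by_cases hL : 1 ≤ L
  · simp only [hL, show 0 < L + 1 by omega, show 1 < L + 1 by omega, lt_add_one, if_true]
    ring
  · simp only [hL, show 0 < L + 1 by omega, show ¬ 1 < L + 1 by omega, lt_add_one, if_true,
      if_false]
    ring

/-- The scalar form of `N₂ M N₁ᵀ = P` for the body of the first kind with `ε = 0`. -/
lemma sum_bodyBlockZeroFirst {R : Type*} [CommRing R] {k L : ℕ} (hk : k = L + 1)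
    (u t p : ℕ → R) (x h : R) (hh : h * 2 = 1) (hu0 : u 0 = 1) (hu1 : u 1 = 2 * x)
    (hu : ∀ j, u (j + 2) = 2 * x * u (j + 1) - u j)
    (ht0 : t 0 = 1) (ht1 : t 1 = h * u 1) (ht : ∀ j, t (j + 2) = h * (u (j + 2) - u j)) :
    ∑ a ∈ Finset.range (L + 1), u (L - a) * (h *
      ((if a = 0 then 2 * x * p k else 0) + p (k - 1 - a) + (if a = k - 1 then p 0 else 0)
        - (if 1 ≤ a then p (k + 1 - a) else 0) - (if a = 1 then p k else 0)))
      = ∑ i ∈ Finset.range (k + 1), t i * p i := by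
  subst hk
  rcases L with _ | l
  · simp [Finset.sum_range_succ, hu0, ht0, ht1, hu1]
    linear_combination (p 0) * hh
  -- The coefficient `-2 P_k` at `a = 1` has two sources: one `-P_k` belongs to the recurrence for
  -- `u (l + 2)`, the other to the difference `u (j + 2) - u j` in `ht`. The doubled `P_0` offsets
  -- the factor `h`, since `t 0` is not half of `u 0`.
  have hsplit : ∀ a ∈ Finset.range (l + 1 + 1), u (l + 1 - a) * (h *
      ((if a = 0 then 2 * x * p (l + 1 + 1) else 0) + p (l + 1 + 1 - 1 - a)
        + (if a = l + 1 + 1 - 1 then p 0 else 0)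
        - (if 1 ≤ a then p (l + 1 + 1 + 1 - a) else 0) - (if a = 1 then p (l + 1 + 1) else 0)))
      = h * ((if a = 0 then u (l + 1) * (2 * x) * p (l + 2) else 0)
        + u (l + 1 + 1 - 1 - a) * p (l + 1 + 1 - 1 - a) + (if a = l + 1 then p 0 else 0)
        - (if 1 ≤ a then u (l + 1 - a) * p (l + 1 - a + 2) else 0)
        - (if a = 1 then u l * p (l + 2) else 0)) := by
    intro a ha
    have ha' := Finset.mem_range.1 ha
    rw [show l + 1 + 1 + 1 - a = l + 1 - a + 2 by omega]
    by_cases h0 : a = 0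
    · subst h0
      simp
      ring
    by_cases h1 : a = 1
    · subst h1
      by_cases hl : l = 0
      · subst hl
        simp [hu0]
      · simp [hl]
        ring
    by_cases h2 : a = l + 1
    · subst h2
      have hl : l ≠ 0 := by omega
      simp [hu0, hl]
    · simp [h0, h1, h2, Nat.one_le_iff_ne_zero]
      ring
  have h1 : ∑ a ∈ Finset.range (l + 1 + 1), u (l + 1 + 1 - 1 - a) * p (l + 1 + 1 - 1 - a)
      = ∑ j ∈ Finset.range l, u (j + 2) * p (j + 2) + u 1 * p 1 + p 0 := by
    rw [Finset.sum_range_reflect (fun j => u j * p j), Finset.sum_range_succ',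
      Finset.sum_range_succ', hu0]
    simp
  have h2 : ∑ a ∈ Finset.range (l + 1 + 1),
      (if 1 ≤ a then u (l + 1 - a) * p (l + 1 - a + 2) else 0)
      = ∑ j ∈ Finset.range (l + 1), u j * p (j + 2) := by
    rw [Finset.sum_range_succ', ← Finset.sum_range_reflect (fun j => u j * p (j + 2))]
    simp
  have h3 : ∑ i ∈ Finset.range (l + 1 + 1 + 1), t i * p i
      = h * (∑ j ∈ Finset.range l, u (j + 2) * p (j + 2) + u (l + 2) * p (l + 2)
        - ∑ j ∈ Finset.range (l + 1), u j * p (j + 2) + u 1 * p 1) + p 0 := by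
    rw [Finset.sum_range_succ', Finset.sum_range_succ', ht0,
      ← Finset.sum_range_succ (fun j => u (j + 2) * p (j + 2)), ← Finset.sum_sub_distrib, mul_add,
      Finset.mul_sum]
    simp only [zero_add, one_mul]
    rw [ht1]
    congr 2
    · refine Finset.sum_congr rfl fun j _ => ?_
      rw [ht]
      ring
    · ring
  rw [Finset.sum_congr rfl hsplit, ← Finset.mul_sum, h3]
  simp only [Finset.sum_add_distrib, Finset.sum_sub_distrib, Finset.sum_ite_eq',
    Finset.mem_range]
  rw [h1, h2, hu]
  simp
  linear_combination (p 0) * hh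

/-! ### The product `N₂ M N₁ᵀ` for the block bodies -/

lemma scalarRow_mul_mul_transpose {α β : Type*} [Fintype α] [Fintype β] {m n : ℕ} (μ : α → ℂ[X])
    (ν : β → ℂ[X]) (M : Matrix (α × Fin m) (β × Fin n) ℂ[X]) (i : Fin m) (j : Fin n) :
    (scalarRow m μ * M * (scalarRow n ν).transpose) i j
      = ∑ a, ∑ b, μ a * M (a, i) (b, j) * ν b := by
  simp only [Matrix.mul_apply, Matrix.transpose_apply, scalarRow, Matrix.of_apply,
    Fintype.sum_prod_type, ite_mul, zero_mul, mul_ite, mul_zero, Finset.sum_ite_eq,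
    Finset.mem_univ, if_true, Finset.sum_mul]
  exact Finset.sum_comm

lemma ite_zero_apply {ρ κ : Type*} (c : Prop) [Decidable c] (A : Matrix ρ κ ℂ[X]) (i : ρ) (j : κ) :
    (if c then A else 0) i j = if c then A i j else 0 := by
  split_ifs <;> rfl

lemma phi_second_one : phi .second 1 = 2 * X := by
  simp [phi]

/-- Both sides obey the same recurrence in `j`. The parameter `v` plays the role of `φ_{e-1}`, so
that `e = 0` is covered as well. -/
lemma phi_second_mul_phi (r : Kind) (e j : ℕ) (v : ℂ[X])
    (hv : phi r (e + 1) = 2 * X * phi r e - v) :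
    phi r (e + (j + 1)) = phi .second (j + 1) * phi r e - phi .second j * v := by
  induction j using Nat.twoStepInduction with
  | zero =>
    rw [zero_add, hv, phi_second_one, phi_zero, one_mul]
  | one =>
    rw [show e + (1 + 1) = e + 2 from rfl, phi_add_two, phi_add_two, hv, phi_zero, zero_add,
      phi_second_one]
    ring
  | more j h1 h2 =>
    rw [show e + (j + 2 + 1) = e + (j + 1) + 2 by omega, phi_add_two,
      show e + (j + 1) + 1 = e + (j + 1 + 1) by omega, h1, h2,
      show j + 2 + 1 = j + 1 + 2 by omega, phi_add_two .second (j + 1), phi_add_two .second j]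
    ring

lemma hasGrade_bodyBlock {m n : ℕ} (r : Kind) (k ε : ℕ) (P : ℕ → Matrix (Fin m) (Fin n) ℂ)
    (a b : ℕ) : HasGrade 1 (bodyBlock r k ε P a b) := by
  have hX : (2 * X : ℂ[X]).natDegree ≤ 1 := by
    rw [show (2 : ℂ[X]) = C 2 from rfl, natDegree_C_mul_X _ two_ne_zero]
  have hP : ∀ A : Matrix (Fin m) (Fin n) ℂ, HasGrade 1 ((2 * X : ℂ[X]) • const A) := fun A =>
    (hasGrade_const 0 A).smul hX le_rfl
  have hc : ∀ A : Matrix (Fin m) (Fin n) ℂ, HasGrade 1 (const A) := hasGrade_const 1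
  have hgen : HasGrade 1 (bodyBlockGeneral k ε P a b) :=
    (((((hP _).ite _).add ((hc _).ite _)).sub ((hc _).ite _)).sub ((hc _).ite _)).add
      ((hc _).ite _)
  cases r
  · simp only [bodyBlock]
    split_ifs
    · exact (((((((hP _).ite _).add (hc _)).add ((hc _).ite _)).sub ((hc _).ite _)).sub
        ((hc _).ite _))).smul (natDegree_C _).le le_rfl
    · exact hgen
  · exact hgen

lemma hasGrade_chebK (r : Kind) (q n : ℕ) : HasGrade 1 (chebK r q n) :=
  hasGrade_scalarBlocks (hasGrade_chebScalar r q)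

lemma hasGrade_bodyAB {m n : ℕ} (r : Kind) (k ε : ℕ) (P : ℕ → Matrix (Fin m) (Fin n) ℂ)
    (A : Matrix (Fin (k - 1 - ε + 1) × Fin m) (Fin ε × Fin n) ℂ)
    (B : Matrix (Fin (k - 1 - ε) × Fin m) (Fin (ε + 1) × Fin n) ℂ) :
    HasGrade 1 (bodyAB r k ε P A B) := by
  refine HasGrade.add (HasGrade.add (fun x y => hasGrade_bodyBlock r k ε P _ _ _ _) ?_) ?_
  · exact (hasGrade_const 0 A).mul (hasGrade_chebK r ε n)
  · exact (hasGrade_chebK _ _ m).transpose.mul (hasGrade_const 0 B)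

lemma chebSum_apply {m n : ℕ} (r : Kind) (k : ℕ) (P : ℕ → Matrix (Fin m) (Fin n) ℂ) (i : Fin m)
    (j : Fin n) : chebSum r k P i j = ∑ l ∈ Finset.range (k + 1), phi r l * C (P l i j) := by
  simp [chebSum, Matrix.sum_apply, const]

lemma hasGrade_chebSum {m n : ℕ} (r : Kind) (k : ℕ) (P : ℕ → Matrix (Fin m) (Fin n) ℂ) :
    HasGrade k (chebSum r k P) := by
  intro i j
  rw [chebSum_apply]
  refine natDegree_sum_le_of_forall_le _ _ fun l hl => natDegree_mul_le.trans ?_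
  rw [natDegree_phi, natDegree_C, add_zero]
  exact Nat.lt_succ_iff.1 (Finset.mem_range.1 hl)

/-- For `ε = 0` there is no second block column to carry `φ_{ε-1}`, so that term has to vanish:
`U_{-1} = 0`, but `T_{-1} = X`. Hence `hr`. -/
lemma scalarRow_mul_bodyBlockGeneral {m n k ε : ℕ} (r : Kind) (hε : ε < k)
    (hr : ε = 0 → r = .second) (P : ℕ → Matrix (Fin m) (Fin n) ℂ) (i : Fin m) (j : Fin n) :
    ∑ a : Fin (k - 1 - ε + 1), ∑ b : Fin (ε + 1), phiVec .second (k - 1 - ε) a *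
      bodyBlockGeneral k ε P a b i j * phiVec r ε b = chebSum r k P i j := by
  obtain ⟨v, hv, hv1, hv0⟩ : ∃ v, phi r (ε + 1) = 2 * X * phi r ε - v ∧
      (ε ≠ 0 → v = phi r (ε - 1)) ∧ (ε = 0 → v = 0) := by
    rcases ε with _ | e
    · refine ⟨0, ?_, by simp, fun _ => rfl⟩
      rw [hr rfl]
      simp [phi]
    · exact ⟨phi r e, phi_add_two r e, fun _ => rfl, by simp⟩
  have hu : phi .second (k - 1 - ε + 1) = 2 * X * phi .second (k - 1 - ε)
      - if 1 ≤ k - 1 - ε then phi .second (k - 1 - ε - 1) else 0 := by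
    rcases hL : k - 1 - ε with _ | l
    · simp [phi]
    · simp [phi_add_two]
  rw [chebSum_apply, ← sum_bodyBlockGeneral (k := k) (L := k - 1 - ε) (ε := ε) (by omega)
    (phi .second) (phi r) (fun l => C (P l i j)) X v (phi_zero _) hu
    (fun l => phi_second_mul_phi r ε l v hv) hv1 hv0, ← Fin.sum_univ_eq_sum_range
    (fun a => ∑ b ∈ Finset.range (ε + 1), _)]
  refine Finset.sum_congr rfl fun a _ => ?_
  rw [← Fin.sum_univ_eq_sum_range]
  refine Finset.sum_congr rfl fun b _ => ?_
  simp only [bodyBlockGeneral, phiVec, Matrix.add_apply, Matrix.sub_apply, ite_zero_apply,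
    Matrix.smul_apply, const, Matrix.map_apply, smul_eq_mul]

lemma scalarRow_mul_bodyBlockZeroFirst {m n k : ℕ} (hk : 0 < k)
    (P : ℕ → Matrix (Fin m) (Fin n) ℂ) (i : Fin m) (j : Fin n) :
    ∑ a : Fin (k - 1 - 0 + 1), ∑ b : Fin (0 + 1), phiVec .second (k - 1 - 0) a *
      bodyBlockZeroFirst k P a i j * phiVec .first 0 b = chebSum .first k P i j := by
  have hh : (C (1 / 2) : ℂ[X]) * 2 = 1 := by
    rw [show (2 : ℂ[X]) = C 2 from rfl, ← C_mul]
    norm_num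
  have hcancel : ∀ f g : ℂ[X], 2 * f = g → f = C (1 / 2) * g := by
    rintro f _ rfl
    rw [← mul_assoc, hh, one_mul]
  rw [chebSum_apply, ← sum_bodyBlockZeroFirst (k := k) (L := k - 1 - 0) (by omega)
    (phi .second) (phi .first) (fun l => C (P l i j)) X (C (1 / 2)) hh (phi_zero _)
    (by simp [phi]) (fun l => phi_add_two _ l) (phi_zero _)
    (hcancel _ _ (by simp [phi]))
    (fun l => hcancel _ _ (by simpa [phi] using Chebyshev.two_mul_T_eq_U_sub_U ℂ l)),
    ← Fin.sum_univ_eq_sum_range]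
  refine Finset.sum_congr rfl fun a _ => ?_
  simp only [bodyBlockZeroFirst, phiVec, Matrix.add_apply, Matrix.sub_apply, ite_zero_apply,
    Matrix.smul_apply, const, Matrix.map_apply, smul_eq_mul]
  simp [phi_zero]

lemma scalarRow_mul_body {m n k ε : ℕ} (r : Kind) (hε : ε < k)
    (P : ℕ → Matrix (Fin m) (Fin n) ℂ) :
    scalarRow m (phiVec .second (k - 1 - ε)) * body r k ε P * (scalarRow n (phiVec r ε)).transpose
      = chebSum r k P := by
  ext1 i j
  rw [scalarRow_mul_mul_transpose]
  cases r
  · by_cases h : ε = 0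
    · subst h
      exact scalarRow_mul_bodyBlockZeroFirst hε P i j
    · simp only [body, bodyBlock, Matrix.of_apply, h, if_false]
      exact scalarRow_mul_bodyBlockGeneral _ hε (fun h' => absurd h' h) P i j
  · exact scalarRow_mul_bodyBlockGeneral _ hε (fun _ => rfl) P i j

lemma scalarRow_mul_bodyAB {m n k ε : ℕ} (r : Kind) (hε : ε < k)
    (P : ℕ → Matrix (Fin m) (Fin n) ℂ)
    (A : Matrix (Fin (k - 1 - ε + 1) × Fin m) (Fin ε × Fin n) ℂ)
    (B : Matrix (Fin (k - 1 - ε) × Fin m) (Fin (ε + 1) × Fin n) ℂ) :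
    scalarRow m (phiVec .second (k - 1 - ε)) * bodyAB r k ε P A B *
      (scalarRow n (phiVec r ε)).transpose = chebSum r k P := by
  obtain ⟨-, -, -, -, h₁, -⟩ := hasComplement_chebK r ε n
  obtain ⟨-, -, -, -, h₂, -⟩ := hasComplement_chebK .second (k - 1 - ε) m
  have h₂' : scalarRow m (phiVec .second (k - 1 - ε)) *
      (chebK .second (k - 1 - ε) m).transpose = 0 := by
    simpa using congrArg Matrix.transpose h₂
  rw [bodyAB, K₁, K₂, Matrix.mul_add, Matrix.mul_add, Matrix.add_mul, Matrix.add_mul,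
    scalarRow_mul_body r hε, ← Matrix.mul_assoc _ _ (const B), h₂',
    Matrix.mul_assoc _ _ (scalarRow n _).transpose, Matrix.mul_assoc (const A), h₁]
  simp

end
end ChebPencil

/-! ### The pencil and its reversal -/

open ChebPencil in
theorem mainTheorem3 (r : ChebPencil.Kind) (m n k ε : ℕ) (hm : 0 < m) (hn : 0 < n) (hε : ε < k)
    (P : ℕ → Matrix (Fin m) (Fin n) ℂ)
    (A : Matrix (Fin (k - 1 - ε + 1) × Fin m) (Fin ε × Fin n) ℂ)
    (B : Matrix (Fin (k - 1 - ε) × Fin m) (Fin (ε + 1) × Fin n) ℂ) :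
    ChebPencil.IsStrongBlockMinimalBasisPencil
        (ChebPencil.bodyAB r k ε P A B) (ChebPencil.K₁ r ε n) (ChebPencil.K₂ k ε m) ∧
      ChebPencil.IsStrongLinearization k
        (ChebPencil.blockPencil
          (ChebPencil.bodyAB r k ε P A B) (ChebPencil.K₁ r ε n) (ChebPencil.K₂ k ε m))
        (ChebPencil.chebSum r k P) := by
  have hM := hasGrade_bodyAB r k ε P A B
  have hK₁ : HasGrade 1 (K₁ r ε n) := hasGrade_chebK r ε n
  have hK₂ : HasGrade 1 (K₂ k ε m) := hasGrade_chebK _ _ m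
  have hN₁ := hasGrade_scalarRow_phiVec r ε n
  have hN₂ := hasGrade_scalarRow_phiVec .second (k - 1 - ε) m
  have hL := hasGrade_blockPencil hM hK₁ hK₂
  have hP := scalarRow_mul_bodyAB r hε P A B
  have hc₁ : Fintype.card (Fin (ε + 1) × Fin n) = Fintype.card (Fin ε × Fin n) + n := by
    simp only [Fintype.card_prod, Fintype.card_fin]
    ring
  have hc₂ : Fintype.card (Fin (k - 1 - ε + 1) × Fin m)
      = Fintype.card (Fin (k - 1 - ε) × Fin m) + m := by
    simp only [Fintype.card_prod, Fintype.card_fin]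
    ring
  refine ⟨⟨hL, isStrongMinimalBasis_chebK r ε n, isStrongMinimalBasis_chebK _ _ m⟩,
    hasGrade_chebSum r k P, ?_, ?_⟩
  · rw [← hP]
    exact isLinearization_blockPencil hL (hasComplement_chebK r ε n)
      (hasComplement_chebK _ _ m) hc₁ hc₂
  -- Reversal is multiplicative when grades add, and `(k - 1 - ε) + 1 + ε = k`. The reversed
  -- polynomial is therefore the product attached to the reversed block pencil.
  · have hrev : rev k (chebSum r k P) = rev (k - 1 - ε) (scalarRow m (phiVec .second (k - 1 - ε))) *
        rev 1 (bodyAB r k ε P A B) * (rev ε (scalarRow n (phiVec r ε))).transpose := by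
      have h := rev_mul (hN₂.mul hM) hN₁.transpose
      rw [rev_mul hN₂ hM, hP, show k - 1 - ε + 1 + ε = k by omega] at h
      exact h
    rw [rev_blockPencil, hrev]
    exact isLinearization_blockPencil (hasGrade_blockPencil hM.rev hK₁.rev hK₂.rev)
      (hasComplement_rev_chebK r ε n) (hasComplement_rev_chebK _ _ m) hc₁ hc₂
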